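/- Gaussian state energy upper bound. Let $\gamma_1,\dots,\gamma_{2n}$ be the Majorana operators on $n$ fermionic modes, in the Weyl--Brauer representation as $2^n\times 2^n$ matrices ($\gamma_{2k-1}=Z^{\otimes (k-1)}\otimes X\otimes \mathbb I^{\otimes (n-k)}$, $\gamma_{2k}=Z^{\otimes (k-1)}\otimes Y\otimes \mathbb I^{\otimes (n-k)}$ with the Pauli matrices $X,Y,Z$). For $p\in(0,1]$ the sparse SYK model is the random Hamiltonian $$H=\binom{2n}{4}^{-1/2}p^{-1/2}\, i^{2}\sum_{i_1<i_2<i_3<i_4} J_{i_1i_2i_3i_4}X_{i_1i_2i_3i_4}\,\gamma_{i_1}\gamma_{i_2}\gamma_{i_3}\gamma_{i_4},$$ where the $J_I$ are standard Gaussian random variables, the $X_I$ are Bernoulli random variables with $\Pr(X_I=1)=p$, and all of these are independent. A pure fermionic Gaussian state is a vector $U|0\rangle^{\otimes n}$ with $U$ a unitary such that $U^\dagger\gamma_iU=\sum_j R_{ij}\gamma_j$ for all $i$, for some $R\in SO(2n)$; in density matrix form, (pure or mixed) fermionic Gaussian states are the matrices $\rho=2^{-n}\prod_{j=1}^n(\mathbb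 I+i\lambda_j\tilde\gamma_{2j-1}\tilde\gamma_{2j})$ with $\lambda_j\in[-1,1]$ and $\tilde\gamma_i=U^\dagger\gamma_iU$ for such a $U$. For every constant $C_0>0$ there are constants $K>0$, $k\in\mathbb N$, $a,b>0$ and $n_0$, depending only on $C_0$, such that for all $n\ge n_0$ and all $p\in[0,1]$ with $p\ge C_0\log n/n$, with probability at least $1-e^{-b n^{a}}$ over the draw of $H$, every fermionic Gaussian state $\rho$ (pure or mixed) on $n$ modes has energy $$\operatorname{Tr}(H\rho)\le K(\log n)^k\,p^{-1/2}.$$ That is, if $p\geq\Omega(\log n/n)$, then Gaussian states achieve energy at most $\widetilde O(p^{-1/2})$, with probability exponentially close to $1$. -/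

import Mathlib

open MeasureTheory ProbabilityTheory

namespace SSYK

noncomputable section

/-- Labels of the computational basis of `n` qubits. -/
abbrev Basis (n : ℕ) : Type := Fin n → Fin 2

/-- Operators on `n` qubits (equivalently, on `n` fermionic modes), as `2 ^ n × 2 ^ n` matrices. -/
abbrev Operator (n : ℕ) : Type := Matrix (Basis n) (Basis n) ℂ

/-- The Pauli matrix `X`. -/
def pauliX : Matrix (Fin 2) (Fin 2) ℂ := !![0, 1; 1, 0]

/-- The Pauli matrix `Y`. -/
def pauliY : Matrix (Fin 2) (Fin 2) ℂ := !![0, -Complex.I; Complex.I, 0]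

/-- The Pauli matrix `Z`. -/
def pauliZ : Matrix (Fin 2) (Fin 2) ℂ := !![1, 0; 0, -1]

/-- The tensor product `A 0 ⊗ A 1 ⊗ ⋯ ⊗ A (n - 1)` of one-qubit matrices. -/
def tensor {n : ℕ} (A : Fin n → Matrix (Fin 2) (Fin 2) ℂ) : Operator n :=
  Matrix.of fun x y => ∏ k, A k (x k) (y k)

/-- The Majorana operators in the Weyl--Brauer representation, indexed from `0`: with `m = i / 2`,
the operator `majorana n i` is `Z ⊗ ⋯ ⊗ Z ⊗ X ⊗ 1 ⊗ ⋯ ⊗ 1` (for even `i`) or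
`Z ⊗ ⋯ ⊗ Z ⊗ Y ⊗ 1 ⊗ ⋯ ⊗ 1` (for odd `i`), where `X` resp. `Y` acts on the qubit `m`. -/
def majorana (n : ℕ) (i : Fin (2 * n)) : Operator n :=
  tensor fun k =>
    if (k : ℕ) < (i : ℕ) / 2 then pauliZ
    else if (k : ℕ) = (i : ℕ) / 2 then (if (i : ℕ) % 2 = 0 then pauliX else pauliY)
    else 1

/-- The set of `q`-element subsets of the `2 n` Majorana indices. -/
abbrev Interaction (n q : ℕ) : Type := {I : Finset (Fin (2 * n)) // I.card = q}

/-- The product `γ_{i₁} ⋯ γ_{i_q}` over `I = {i₁ < ⋯ < i_q}`, in increasing order. -/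
def majoranaProd (n : ℕ) (I : Finset (Fin (2 * n))) : Operator n :=
  ((I.sort (· ≤ ·)).map (majorana n)).prod

/-- The sparse SYK-`q` Hamiltonian with sparsity parameter `p`, couplings `J` and
sparsification variables `X`:
`binom(2n, q)^(-1/2) * p^(-1/2) * i^(q/2) * ∑_I J_I X_I γ_I`. -/
def hamiltonian (n q : ℕ) (p : ℝ) (J X : Interaction n q → ℝ) : Operator n :=
  (((√((2 * n).choose q : ℝ))⁻¹ * (√p)⁻¹ : ℝ) * Complex.I ^ (q / 2) : ℂ) •
    ∑ I : Interaction n q, ((J I * X I : ℝ) : ℂ) • majoranaProd n I.1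

/-- The disorder of the sparse SYK-`q` model: the `J_I` are standard Gaussian random variables,
the `X_I` are Bernoulli random variables with `ℙ(X_I = 1) = p`, and all these random variables
are (jointly) independent. -/
structure IsDisorder {Ω : Type*} [MeasurableSpace Ω] (μ : Measure Ω) {n q : ℕ} (p : unitInterval)
    (J X : Interaction n q → Ω → ℝ) : Prop where
  law_J : ∀ I, HasLaw (J I) (gaussianReal 0 1) μ
  law_X : ∀ I, HasLaw (X I) (bernoulliMeasure (1 : ℝ) 0 p) μ
  indep : iIndepFun (Sum.elim J X) μ

/-- The unitary `U` implements the rotation `R ∈ SO(2n)` of the Majorana operators: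
`U† γ_i U = ∑_j R_{ij} γ_j`. -/
def Implements {n : ℕ} (U : Operator n) (R : Matrix (Fin (2 * n)) (Fin (2 * n)) ℝ) : Prop :=
  U ∈ Matrix.unitaryGroup (Basis n) ℂ ∧
  R ∈ Matrix.specialOrthogonalGroup (Fin (2 * n)) ℝ ∧
  ∀ i, U.conjTranspose * majorana n i * U = ∑ j, ((R i j : ℝ) : ℂ) • majorana n j

/-- The state `|0⟩ ⊗ ⋯ ⊗ |0⟩`. -/
def zeroState (n : ℕ) : Basis n → ℂ := Pi.single 0 1

/-- Pure fermionic Gaussian state vectors `|ψ⟩ = U_R |0 ⋯ 0⟩`. -/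
def IsPureGaussian {n : ℕ} (ψ : Basis n → ℂ) : Prop :=
  ∃ U R, Implements U R ∧ ψ = U.mulVec (zeroState n)

/-- The operator `2^(-n) ∏_j (1 + i λ_j γ'_{2j-1} γ'_{2j})`, with `γ'_i = U† γ_i U`. -/
def gaussianDensity {n : ℕ} (U : Operator n) (lam : Fin n → ℝ) : Operator n :=
  ((2 : ℂ) ^ n)⁻¹ • (List.ofFn fun j : Fin n =>
    1 + (Complex.I * (lam j : ℂ)) •
      ((U.conjTranspose * majorana n ⟨2 * j, by omega⟩ * U) *
        (U.conjTranspose * majorana n ⟨2 * j + 1, by omega⟩ * U))).prod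

/-- Density matrices of fermionic Gaussian states: the projections `|ψ⟩⟨ψ|` on pure Gaussian
states, and the (pure or mixed) Gaussian states in the standard density matrix form. -/
def IsGaussian {n : ℕ} (ρ : Operator n) : Prop :=
  (∃ ψ, IsPureGaussian ψ ∧ ρ = Matrix.vecMulVec ψ (star ψ)) ∨
  (∃ U R lam, Implements U R ∧ (∀ j, lam j ∈ Set.Icc (-1 : ℝ) 1) ∧ ρ = gaussianDensity U lam)

/-- The energy `Tr(H ρ)` of the density matrix `ρ`. It is a real number when `H` and `ρ` are
Hermitian. For `ρ = |ψ⟩⟨ψ|` it is `⟨ψ|H|ψ⟩`. -/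
def energy {n : ℕ} (H ρ : Operator n) : ℝ := (H * ρ).trace.re

end

end SSYK

/-!
The energy of a Gaussian state is a quadratic form in its covariance matrix, and the operator norm
of the random matrix of this form is controlled by an `ε`-net argument.

*Wick's formula.* A Gaussian state `ρ` satisfies `[γ_a, ρ] = i ∑_b Γ_ab {γ_b, ρ}` for a real
matrix `Γ` (`HasCovariance`). For the product form this is a relation between the two Majorana
operators in each factor `1 + i λ_j γ_{2j} γ_{2j+1}`, and for a pure state it says that
`γ_{2j} + i γ_{2j+1}` annihilates `|0 ⋯ 0⟩`; rotations turn `Γ` into `R Γ Rᵀ`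
(`HasCovariance.rotate`, `IsGaussian.exists_hasCovariance`). The block form of `Γ` shows that its
squared Frobenius norm is at most `2 n`. Together with the Clifford relations, the commutator
relation expresses `Tr (γ_a γ_b γ_c γ_d ρ)` as a `4 × 4` Pfaffian of `Γ`
(`HasCovariance.trace_mul_four`). Hence the energy is `binom(2n, 4)^(-1/2) p^(-1/2)` times
`B(Γ, Γ)`, where `B` is the random bilinear form `∑_I J_I X_I Pf_I` and `Pf_I` is a bilinear form
which extends the Pfaffian on the rows `I` (`pairing`).

*Operator norm.* For fixed matrices `M`, `M'` of Frobenius norm at most `1` one has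
`∑_I Pf_I(M, M')² ≤ 9`, and `J_I X_I` is sub-Gaussian with variance proxy `1` whatever `p` is, so
that `B(M, M')` exceeds `18 n` with probability at most `exp (-18 n²)`. The unit ball of the
`4 n²`-dimensional space of matrices has a `1/2`-net of at most `5 ^ (4 n²)` points, so with
probability at least `1 - exp (-n²)` the form `B` is at most `18 n` on all pairs of points of
the net, hence at most `72 n` on the ball (`IsDisorder.exists_bad_event`). On `Γ` it is then at
most `2 n * 72 n`, and dividing by `binom(2n, 4)^(1/2) ≥ n² / 5` leaves a constant times `p^(-1/2)`.
In particular the bound holds with a constant in place of the power of the logarithm. For `p = 0`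
the Hamiltonian vanishes, as does `p^(-1/2)`, by the conventions on inverses.
-/

namespace SSYK

open Matrix

/-! ### Clifford relations and Wick's formula for four Majorana operators -/

section Clifford

variable {ι m : Type*} [Fintype ι] [DecidableEq ι] [Fintype m] [DecidableEq m]

/-- The canonical anticommutation relations `γ_i γ_j + γ_j γ_i = 2 δ_ij` of Majorana operators. -/
def IsClifford (γ : ι → Matrix m m ℂ) : Prop :=
  ∀ i j, γ i * γ j + γ j * γ i = (if i = j then (2 : ℂ) else 0) • 1

/-- `ρ` has unit trace and satisfies `[γ_a, ρ] = i ∑_b Γ_ab {γ_b, ρ}` for all `a`.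
Modulo the Clifford relations, this determines the moments `Tr (γ_{i₁} ⋯ γ_{i_k} ρ)` with `k` even
by Wick's formula, and in particular `Tr (γ_b γ_a ρ) = δ_ab + i Γ_ab`. Gaussian states have this
property which, unlike a product formula, is visibly covariant under rotations of the `γ_a`.
Antisymmetry of `Γ` is not part of the definition. -/
structure HasCovariance (γ : ι → Matrix m m ℂ) (ρ : Matrix m m ℂ) (Γ : Matrix ι ι ℝ) : Prop where
  trace_eq : ρ.trace = 1
  commutator : ∀ a, γ a * ρ - ρ * γ a =
    Complex.I • ∑ b, (Γ a b : ℂ) • (γ b * ρ + ρ * γ b)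

omit [DecidableEq ι] in
lemma HasCovariance.trace_commutator {γ : ι → Matrix m m ℂ} {ρ : Matrix m m ℂ} {Γ : Matrix ι ι ℝ}
    (h : HasCovariance γ ρ Γ) (x : Matrix m m ℂ) (a : ι) :
    (x * γ a * ρ).trace - (γ a * x * ρ).trace =
      Complex.I * ∑ b, (Γ a b : ℂ) * ((x * γ b + γ b * x) * ρ).trace := by
  have key : ∀ b, (γ b * (x * ρ)).trace = (x * (ρ * γ b)).trace := fun b => by
    rw [trace_mul_comm, mul_assoc]
  have h1 := congrArg (fun y => (x * y).trace) (h.commutator a)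
  simp only [mul_sub, trace_sub, mul_smul_comm, trace_smul, Finset.mul_sum, trace_sum, mul_add,
    trace_add, smul_eq_mul] at h1
  simp only [add_mul, trace_add, Finset.mul_sum, mul_add, mul_assoc, key] at h1 ⊢
  exact h1

lemma HasCovariance.trace_mul_two {γ : ι → Matrix m m ℂ} {ρ : Matrix m m ℂ} {Γ : Matrix ι ι ℝ}
    (hγ : IsClifford γ) (h : HasCovariance γ ρ Γ) {c a : ι} (hca : c ≠ a) :
    (γ c * γ a * ρ).trace = Complex.I * Γ a c := by
  have h1 := h.trace_commutator (γ c) a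
  have h2 : (γ c * γ a * ρ).trace + (γ a * γ c * ρ).trace = 0 := by
    rw [← trace_add, ← add_mul, hγ, if_neg hca, zero_smul, zero_mul, trace_zero]
  have h3 : ∀ b, ((γ c * γ b + γ b * γ c) * ρ).trace = if c = b then 2 else 0 := fun b => by
    rw [hγ, smul_mul_assoc, one_mul, trace_smul, h.trace_eq, smul_eq_mul, mul_one]
  simp only [h3, mul_ite, mul_zero, Finset.sum_ite_eq, Finset.mem_univ, if_true] at h1
  linear_combination (h1 + h2) / 2

omit [Fintype ι] in
lemma IsClifford.anticommutator_three {γ : ι → Matrix m m ℂ} (hγ : IsClifford γ) (c d e b : ι) :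
    γ c * γ d * γ e * γ b + γ b * (γ c * γ d * γ e) =
      (if e = b then (2 : ℂ) else 0) • (γ c * γ d) - (if d = b then (2 : ℂ) else 0) • (γ c * γ e) +
        (if c = b then (2 : ℂ) else 0) • (γ d * γ e) := by
  have e1 := congrArg (fun y => γ c * γ d * y) (hγ e b)
  have e2 := congrArg (fun y => γ c * y * γ e) (hγ d b)
  have e3 := congrArg (fun y => y * γ d * γ e) (hγ c b)
  simp only [mul_smul_comm, smul_mul_assoc, mul_one, one_mul, mul_add, add_mul] at e1 e2 e3
  rw [← e1, ← e2, ← e3]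
  noncomm_ring

/-- A bilinear expression in `M` and `M'` which for antisymmetric `M = M'` is the `4 × 4`
sub-Pfaffian of `M` on the rows `v 0, …, v 3`. It is not symmetric in `M` and `M'`. -/
def pairing (v : Fin 4 → ι) (M M' : ι → ι → ℝ) : ℝ :=
  M (v 3) (v 2) * M' (v 1) (v 0) - M (v 3) (v 1) * M' (v 2) (v 0) +
    M (v 3) (v 0) * M' (v 2) (v 1)

/-- Wick's formula for four distinct Majorana operators. The anticommutator of `γ_b` with a product
of three Majorana operators is quadratic, so that the commutator relation defining the covariance
reduces the fourth moment to second moments. -/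
lemma HasCovariance.trace_mul_four {γ : ι → Matrix m m ℂ} {ρ : Matrix m m ℂ} {Γ : Matrix ι ι ℝ}
    (hγ : IsClifford γ) (h : HasCovariance γ ρ Γ) {v : Fin 4 → ι} (hv : Function.Injective v) :
    (γ (v 0) * γ (v 1) * γ (v 2) * γ (v 3) * ρ).trace = -(pairing v Γ Γ : ℂ) := by
  have hne : ∀ i j : Fin 4, i ≠ j → v i ≠ v j := fun i j hij => hv.ne hij
  have h1 := h.trace_commutator (γ (v 0) * γ (v 1) * γ (v 2)) (v 3)
  have h2 : (γ (v 0) * γ (v 1) * γ (v 2) * γ (v 3) * ρ).trace +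
      (γ (v 3) * (γ (v 0) * γ (v 1) * γ (v 2)) * ρ).trace = 0 := by
    rw [← trace_add, ← add_mul, hγ.anticommutator_three, if_neg (hne 2 3 (by decide)),
      if_neg (hne 1 3 (by decide)), if_neg (hne 0 3 (by decide))]
    simp
  simp only [hγ.anticommutator_three, add_mul, sub_mul, smul_mul_assoc, trace_add, trace_sub,
    trace_smul, smul_eq_mul, mul_add, mul_sub, Finset.sum_add_distrib, Finset.sum_sub_distrib,
    ite_mul, zero_mul, mul_ite, mul_zero, Finset.sum_ite_eq, Finset.mem_univ, if_true,
    h.trace_mul_two hγ (hne 0 1 (by decide)), h.trace_mul_two hγ (hne 0 2 (by decide)),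
    h.trace_mul_two hγ (hne 1 2 (by decide))] at h1
  simp only [pairing]
  push_cast
  linear_combination (h1 + h2) / 2 + (Γ (v 3) (v 2) * Γ (v 1) (v 0) -
    Γ (v 3) (v 1) * Γ (v 2) (v 0) + Γ (v 3) (v 0) * Γ (v 2) (v 1) : ℂ) * Complex.I_sq

lemma HasCovariance.rotate {γ γ' : ι → Matrix m m ℂ} {ρ : Matrix m m ℂ} {Γ S : Matrix ι ι ℝ}
    (h : HasCovariance γ' ρ Γ) (hS : S ∈ orthogonalGroup ι ℝ)
    (hγ : ∀ i, γ i = ∑ j, (S i j : ℂ) • γ' j) :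
    HasCovariance γ ρ (S * Γ * Sᵀ) := by
  have hγ' : ∀ k, γ' k = ∑ l, (S l k : ℂ) • γ l := fun k => by
    have hS' : Sᵀ * S = 1 := (mem_orthogonalGroup_iff' _ _).1 hS
    simp only [hγ, Finset.smul_sum, smul_smul]
    rw [Finset.sum_comm]
    have : ∀ j, ∑ l, ((S l k : ℂ) * (S l j : ℂ)) • γ' j = (if k = j then (1 : ℂ) else 0) • γ' j :=
      fun j => by
        rw [← Finset.sum_smul]
        congr 1
        have := congrFun (congrFun hS' k) j
        simp only [mul_apply, transpose_apply, one_apply] at this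
        rw [← Complex.ofReal_one, ← Complex.ofReal_zero, ← apply_ite Complex.ofReal, ← this]
        push_cast
        rfl
    simp [this]
  refine ⟨h.trace_eq, fun a => ?_⟩
  have h1 : γ a * ρ - ρ * γ a = ∑ j, (S a j : ℂ) • (γ' j * ρ - ρ * γ' j) := by
    simp only [hγ, Finset.sum_mul, Finset.mul_sum, smul_mul_assoc, mul_smul_comm, smul_sub,
      Finset.sum_sub_distrib]
  have h2 : ∀ k, γ' k * ρ + ρ * γ' k = ∑ l, (S l k : ℂ) • (γ l * ρ + ρ * γ l) := fun k => by
    conv_lhs => rw [hγ' k]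
    simp only [Finset.sum_mul, Finset.mul_sum, smul_mul_assoc, mul_smul_comm, smul_add,
      Finset.sum_add_distrib]
  rw [h1]
  simp only [h.commutator, h2, Finset.smul_sum, smul_smul, mul_apply, transpose_apply]
  push_cast
  simp only [Finset.sum_mul, Finset.mul_sum, Finset.sum_smul]
  rw [Finset.sum_comm' (t' := Finset.univ) (s' := fun _ => Finset.univ) (by simp)]
  rw [Finset.sum_congr rfl (fun k _ => Finset.sum_comm), Finset.sum_comm]
  refine Finset.sum_congr rfl fun l _ => Finset.sum_congr rfl fun k _ =>
    Finset.sum_congr rfl fun j _ => ?_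
  congr 1
  ring

omit [Fintype ι] in
lemma IsClifford.of_conj {γ : ι → Matrix m m ℂ} (hγ : IsClifford γ) {V W : Matrix m m ℂ}
    (hVW : V * W = 1) :
    IsClifford fun i => W * γ i * V := by
  have hWV : W * V = 1 := mul_eq_one_comm.1 hVW
  intro i j
  have : ∀ i j, W * γ i * V * (W * γ j * V) = W * (γ i * γ j) * V := fun i j => by
    calc _ = W * γ i * (V * W) * γ j * V := by noncomm_ring
      _ = _ := by rw [hVW]; noncomm_ring
  rw [this, this, ← add_mul, ← mul_add, hγ, mul_smul_comm, smul_mul_assoc, mul_one, hWV]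

/-- The squared Frobenius norm is invariant under orthogonal conjugation. -/
lemma sum_sq_orthogonal_conj {S Γ : Matrix ι ι ℝ} (hS : S ∈ orthogonalGroup ι ℝ) :
    ∑ i, ∑ j, (S * Γ * Sᵀ) i j ^ 2 = ∑ i, ∑ j, Γ i j ^ 2 := by
  have key : ∀ A : Matrix ι ι ℝ, ∑ i, ∑ j, A i j ^ 2 = (A * Aᵀ).trace := fun A => by
    simp [trace, mul_apply, sq]
  have hS' : Sᵀ * S = 1 := (mem_orthogonalGroup_iff' _ _).1 hS
  rw [key, key, transpose_mul, transpose_mul, transpose_transpose]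
  calc _ = (S * Γ * (Sᵀ * S) * Γᵀ * Sᵀ).trace := by simp only [mul_assoc]
    _ = (Sᵀ * (S * Γ * 1 * Γᵀ)).trace := by rw [hS', trace_mul_comm]
    _ = (Sᵀ * S * (Γ * Γᵀ)).trace := by simp only [mul_one, mul_assoc]
    _ = _ := by rw [hS', one_mul]

end Clifford

/-! ### Majorana operators -/

section Majorana

variable {n : ℕ}

lemma tensor_mul (A B : Fin n → Matrix (Fin 2) (Fin 2) ℂ) :
    tensor A * tensor B = tensor fun k => A k * B k := by
  ext x y
  simp only [tensor, mul_apply, of_apply, ← Finset.prod_mul_distrib]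
  rw [Finset.prod_univ_sum, Fintype.piFinset_univ]

lemma tensor_smul (c : Fin n → ℂ) (A : Fin n → Matrix (Fin 2) (Fin 2) ℂ) :
    (tensor fun k => c k • A k) = (∏ k, c k) • tensor A := by
  ext x y
  simp [tensor, Finset.prod_mul_distrib]

lemma tensor_one : (tensor fun _ : Fin n => (1 : Matrix (Fin 2) (Fin 2) ℂ)) = 1 := by
  ext x y
  simp only [tensor, of_apply, one_apply, Finset.prod_ite_zero, Finset.mem_univ, true_imp_iff,
    Finset.prod_const_one, funext_iff]

lemma tensor_conjTranspose (A : Fin n → Matrix (Fin 2) (Fin 2) ℂ) :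
    (tensor A)ᴴ = tensor fun k => (A k)ᴴ := by
  ext x y
  simp [tensor, conjTranspose_apply]

lemma pauliX_mul_pauliX : pauliX * pauliX = 1 := by
  ext i j; fin_cases i <;> fin_cases j <;> simp [pauliX]

lemma pauliY_mul_pauliY : pauliY * pauliY = 1 := by
  ext i j; fin_cases i <;> fin_cases j <;> simp [pauliY]

lemma pauliZ_mul_pauliZ : pauliZ * pauliZ = 1 := by
  ext i j; fin_cases i <;> fin_cases j <;> simp [pauliZ]

lemma pauliX_mul_pauliY : pauliX * pauliY = (-1 : ℂ) • (pauliY * pauliX) := by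
  ext i j; fin_cases i <;> fin_cases j <;> simp [pauliX, pauliY]

lemma pauliX_mul_pauliZ : pauliX * pauliZ = (-1 : ℂ) • (pauliZ * pauliX) := by
  ext i j; fin_cases i <;> fin_cases j <;> simp [pauliX, pauliZ]

lemma pauliY_mul_pauliZ : pauliY * pauliZ = (-1 : ℂ) • (pauliZ * pauliY) := by
  ext i j; fin_cases i <;> fin_cases j <;> simp [pauliY, pauliZ]

lemma majorana_mul_self (i : Fin (2 * n)) : majorana n i * majorana n i = 1 := by
  rw [majorana, tensor_mul, ← tensor_one]
  congr 1
  funext k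
  split_ifs
  exacts [pauliZ_mul_pauliZ, pauliX_mul_pauliX, pauliY_mul_pauliY, one_mul 1]

/-- Two Majorana operators anticommute: their tensor factors anticommute on exactly one qubit,
the first one on which one of the two operators is `X` or `Y`. -/
lemma majorana_mul_of_lt {i j : Fin (2 * n)} (hij : i < j) :
    majorana n i * majorana n j = -(majorana n j * majorana n i) := by
  have hk : (i : ℕ) / 2 < n := by omega
  have hij' : (i : ℕ) < j := hij
  have hc : ∏ k : Fin n, (if k = ⟨(i : ℕ) / 2, hk⟩ then (-1 : ℂ) else 1) = -1 := by simp
  rw [← neg_one_smul ℂ, ← hc, majorana, majorana, tensor_mul, tensor_mul, ← tensor_smul]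
  congr 1
  funext k
  simp only [Fin.ext_iff]
  split_ifs <;> first
    | omega
    | simp [pauliX_mul_pauliY, pauliX_mul_pauliZ, pauliY_mul_pauliZ]

lemma isClifford_majorana : IsClifford (majorana n) := by
  intro i j
  split_ifs with h
  · rw [h, majorana_mul_self, two_smul]
  · rcases lt_or_gt_of_ne h with h | h
    · rw [majorana_mul_of_lt h, neg_add_cancel, zero_smul]
    · rw [majorana_mul_of_lt h, add_neg_cancel, zero_smul]

lemma majorana_conjTranspose (i : Fin (2 * n)) : (majorana n i)ᴴ = majorana n i := by
  rw [majorana, tensor_conjTranspose]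
  congr 1
  funext k
  split_ifs
  · ext i j; fin_cases i <;> fin_cases j <;> simp [pauliZ]
  · ext i j; fin_cases i <;> fin_cases j <;> simp [pauliX]
  · ext i j; fin_cases i <;> fin_cases j <;> simp [pauliY]
  · exact conjTranspose_one

/-- The operator `γ_{2j} + i γ_{2j+1}` annihilates the state `|0 ⋯ 0⟩`. -/
lemma majorana_mulVec_zeroState (j : Fin n) :
    majorana n ⟨2 * j, by omega⟩ *ᵥ zeroState n =
      -Complex.I • (majorana n ⟨2 * j + 1, by omega⟩ *ᵥ zeroState n) := by
  have hc : ∏ k : Fin n, (if k = j then -Complex.I else 1) = -Complex.I := by simp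
  have h1 : (2 * (j : ℕ) + 1) / 2 = j := by omega
  have h2 : (2 * (j : ℕ) + 1) % 2 = 1 := by omega
  ext x
  simp only [zeroState, mulVec_single_one, col_apply, Pi.smul_apply, smul_eq_mul]
  rw [← hc]
  simp only [majorana, tensor, of_apply, ← Finset.prod_mul_distrib]
  refine Finset.prod_congr rfl fun k _ => ?_
  simp only [h1, h2, Fin.ext_iff, Nat.mul_div_cancel_left _ two_pos, Nat.mul_mod_right]
  by_cases hk : (k : ℕ) = j
  · generalize x k = y
    fin_cases y <;> simp [hk, pauliX, pauliY]
  · simp [hk]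

lemma majoranaProd_eq (I : Interaction n 4) :
    majoranaProd n I.1 = majorana n (I.1.orderEmbOfFin I.2 0) *
      majorana n (I.1.orderEmbOfFin I.2 1) * majorana n (I.1.orderEmbOfFin I.2 2) *
      majorana n (I.1.orderEmbOfFin I.2 3) := by
  have h : I.1.sort (· ≤ ·) = List.ofFn (I.1.orderEmbOfFin I.2) := by
    refine List.ext_getElem (by simp [I.2]) fun i h1 h2 => ?_
    rw [List.getElem_ofFn, Finset.orderEmbOfFin_apply]
    rfl
  rw [majoranaProd, h]
  simp [List.ofFn_succ, mul_assoc]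

end Majorana

/-! ### Covariance of Gaussian states -/

section Gaussian

variable {n : ℕ}

/-- The block diagonal antisymmetric matrix with blocks `[[0, lam j], [-lam j, 0]]`. -/
def blockCovariance (lam : Fin n → ℝ) : Matrix (Fin (2 * n)) (Fin (2 * n)) ℝ :=
  Matrix.of fun a b =>
    if (a : ℕ) % 2 = 0 then (if (b : ℕ) = a + 1 then lam ⟨a / 2, by omega⟩ else 0)
    else (if (b : ℕ) + 1 = a then -lam ⟨a / 2, by omega⟩ else 0)

lemma blockCovariance_even (lam : Fin n → ℝ) (j : Fin n) (b : Fin (2 * n)) :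
    blockCovariance lam ⟨2 * j, by omega⟩ b =
      if b = ⟨2 * j + 1, by omega⟩ then lam j else 0 := by
  simp [blockCovariance, Fin.ext_iff]

lemma blockCovariance_odd (lam : Fin n → ℝ) (j : Fin n) (b : Fin (2 * n)) :
    blockCovariance lam ⟨2 * j + 1, by omega⟩ b =
      if b = ⟨2 * j, by omega⟩ then -lam j else 0 := by
  have h1 : (2 * (j : ℕ) + 1) / 2 = j := by omega
  have h2 : (2 * (j : ℕ) + 1) % 2 = 1 := by omega
  simp [blockCovariance, Fin.ext_iff, h1, h2]

lemma forall_fin_two_mul {P : Fin (2 * n) → Prop} (h0 : ∀ j : Fin n, P ⟨2 * j, by omega⟩)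
    (h1 : ∀ j : Fin n, P ⟨2 * j + 1, by omega⟩) (a : Fin (2 * n)) : P a := by
  rcases Nat.mod_two_eq_zero_or_one a with h | h
  · convert h0 ⟨a / 2, by omega⟩ using 1
    ext; simp only; omega
  · convert h1 ⟨a / 2, by omega⟩ using 1
    ext; simp only; omega

lemma sum_sq_blockCovariance_le {lam : Fin n → ℝ} (hlam : ∀ j, lam j ∈ Set.Icc (-1 : ℝ) 1) :
    ∑ a, ∑ b, blockCovariance lam a b ^ 2 ≤ 2 * n := by
  have hsq : ∀ j, lam j ^ 2 ≤ 1 := fun j => (sq_le_one_iff_abs_le_one _).2 (abs_le.2 (hlam j))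
  have h : ∀ a, ∑ b, blockCovariance lam a b ^ 2 ≤ 1 := by
    refine forall_fin_two_mul (fun j => ?_) fun j => ?_
    · simpa [blockCovariance_even, ite_pow] using hsq j
    · simpa [blockCovariance_odd, ite_pow] using hsq j
  calc _ ≤ ∑ _a : Fin (2 * n), (1 : ℝ) := Finset.sum_le_sum fun a _ => h a
    _ = _ := by simp

lemma hasCovariance_blockCovariance {γ : Fin (2 * n) → Operator n} {ρ : Operator n}
    {lam : Fin n → ℝ} (htr : ρ.trace = 1)
    (h0 : ∀ j : Fin n, γ ⟨2 * j, by omega⟩ * ρ - ρ * γ ⟨2 * j, by omega⟩ =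
      (Complex.I * lam j) • (γ ⟨2 * j + 1, by omega⟩ * ρ + ρ * γ ⟨2 * j + 1, by omega⟩))
    (h1 : ∀ j : Fin n, γ ⟨2 * j + 1, by omega⟩ * ρ - ρ * γ ⟨2 * j + 1, by omega⟩ =
      -(Complex.I * lam j) • (γ ⟨2 * j, by omega⟩ * ρ + ρ * γ ⟨2 * j, by omega⟩)) :
    HasCovariance γ ρ (blockCovariance lam) := by
  refine ⟨htr, forall_fin_two_mul (fun j => ?_) fun j => ?_⟩
  · rw [h0]
    simp only [blockCovariance_even, apply_ite Complex.ofReal, Complex.ofReal_zero, ite_smul,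
      zero_smul, Finset.sum_ite_eq', Finset.mem_univ, if_true, mul_smul]
  · rw [h1]
    simp only [blockCovariance_odd, apply_ite Complex.ofReal, Complex.ofReal_zero, ite_smul,
      zero_smul, Finset.sum_ite_eq', Finset.mem_univ, if_true, Complex.ofReal_neg, neg_smul,
      mul_smul, smul_neg]

section Product

/-- The commutation relation of a single factor `1 + i λ γ_a γ_b` of a Gaussian state. -/
lemma commutator_factor {R : Type*} [Ring R] [Algebra ℂ R] {A B : R} (c : ℂ) (hA : A * A = 1)
    (hB : B * B = 1) (hAB : A * B = -(B * A)) :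
    A * (1 + c • (A * B)) - (1 + c • (A * B)) * A =
        c • (B * (1 + c • (A * B)) + (1 + c • (A * B)) * B) ∧
      B * (1 + c • (A * B)) - (1 + c • (A * B)) * B =
        -c • (A * (1 + c • (A * B)) + (1 + c • (A * B)) * A) := by
  have e1 : A * (A * B) = B := by rw [← mul_assoc, hA, one_mul]
  have e2 : A * B * A = -B := by rw [hAB, neg_mul, mul_assoc, hA, mul_one]
  have e3 : B * (A * B) = -A := by rw [hAB, mul_neg, ← mul_assoc, hB, one_mul]
  have e4 : A * B * B = A := by rw [mul_assoc, hB, mul_one]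
  simp only [mul_add, add_mul, mul_one, one_mul, mul_smul_comm, smul_mul_assoc, e1, e2, e3, e4,
    smul_add, smul_neg, neg_smul]
  constructor <;> abel

variable {γ : Fin (2 * n) → Operator n}

lemma IsClifford.mul_self (hγ : IsClifford γ) (a : Fin (2 * n)) : γ a * γ a = 1 := by
  have h := hγ a a
  rw [if_pos rfl, ← two_smul ℂ] at h
  exact smul_right_injective _ (two_ne_zero (α := ℂ)) h

lemma IsClifford.mul_comm_of_ne (hγ : IsClifford γ) {a b : Fin (2 * n)} (h : a ≠ b) :
    γ a * γ b = -(γ b * γ a) :=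
  eq_neg_of_add_eq_zero_left (by rw [hγ, if_neg h, zero_smul])

lemma IsClifford.commute_pair (hγ : IsClifford γ) {a b c : Fin (2 * n)} (hb : a ≠ b) (hc : a ≠ c) :
    Commute (γ a) (γ b * γ c) := by
  rw [Commute, SemiconjBy, ← mul_assoc, hγ.mul_comm_of_ne hb, neg_mul, mul_assoc,
    hγ.mul_comm_of_ne hc, mul_neg, neg_neg, mul_assoc]

/-- The factor `1 + i λ_j γ_{2j} γ_{2j+1}` of a Gaussian state. -/
noncomputable def gaussianFactor (γ : Fin (2 * n) → Operator n) (lam : Fin n → ℝ) (j : Fin n) :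
    Operator n :=
  1 + (Complex.I * (lam j : ℂ)) • (γ ⟨2 * j, by omega⟩ * γ ⟨2 * j + 1, by omega⟩)

lemma IsClifford.commute_gaussianFactor_prod (hγ : IsClifford γ) (lam : Fin n → ℝ)
    {l : List (Fin n)} {a : Fin (2 * n)} (ha : ∀ j ∈ l, (a : ℕ) / 2 ≠ j) :
    Commute (γ a) (l.map (gaussianFactor γ lam)).prod := by
  refine Commute.list_prod_right _ _ fun x hx => ?_
  obtain ⟨j, hj, rfl⟩ := List.mem_map.1 hx
  have := ha j hj
  exact (Commute.one_right _).add_right ((hγ.commute_pair (by rw [Ne, Fin.ext_iff]; simp; omega)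
    (by rw [Ne, Fin.ext_iff]; simp; omega)).smul_right _)

/-- Only the term `1` in the expansion of the product of factors has a nonzero trace. -/
lemma IsClifford.trace_gaussianFactor_prod (hγ : IsClifford γ) (lam : Fin n → ℝ)
    {l : List (Fin n)} (hl : l.Nodup) :
    (l.map (gaussianFactor γ lam)).prod.trace = 2 ^ n := by
  induction l with
  | nil => simp [trace_one]
  | cons j l ih =>
    obtain ⟨hj, hl⟩ := List.nodup_cons.1 hl
    have hne : ∀ k ∈ l, (j : ℕ) ≠ k := fun k hk h => hj (Fin.ext h ▸ hk)
    set P := (l.map (gaussianFactor γ lam)).prod with hP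
    have h0 : γ ⟨2 * j, by omega⟩ * P = P * γ ⟨2 * j, by omega⟩ :=
      hγ.commute_gaussianFactor_prod lam fun k hk => by simpa using hne k hk
    have hanti : γ ⟨2 * j, by omega⟩ * γ ⟨2 * j + 1, by omega⟩ =
        -(γ ⟨2 * j + 1, by omega⟩ * γ ⟨2 * j, by omega⟩) :=
      hγ.mul_comm_of_ne (by simp)
    -- cyclicity of the trace moves `γ_{2j}` past `γ_{2j+1}`, which changes the sign
    have h1 : (γ ⟨2 * j, by omega⟩ * γ ⟨2 * j + 1, by omega⟩ * P).trace = 0 := by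
      have h2 : (γ ⟨2 * j, by omega⟩ * γ ⟨2 * j + 1, by omega⟩ * P).trace =
          -(γ ⟨2 * j, by omega⟩ * γ ⟨2 * j + 1, by omega⟩ * P).trace := by
        conv_lhs => rw [mul_assoc, trace_mul_comm, mul_assoc, ← h0, ← mul_assoc]
        rw [hanti, neg_mul, trace_neg, neg_neg]
      exact self_eq_neg.1 h2
    rw [List.map_cons, List.prod_cons, ← hP, gaussianFactor, add_mul, one_mul, smul_mul_assoc,
      trace_add, trace_smul, h1, smul_zero, add_zero, ih hl]

lemma IsClifford.hasCovariance_gaussianFactor_prod (hγ : IsClifford γ) (lam : Fin n → ℝ)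
    {l : List (Fin n)} (hl : l.Nodup) (hmem : ∀ j, j ∈ l) :
    HasCovariance γ (((2 : ℂ) ^ n)⁻¹ • (l.map (gaussianFactor γ lam)).prod)
      (blockCovariance lam) := by
  have key : ∀ j : Fin n, ∃ V W : Operator n,
      (l.map (gaussianFactor γ lam)).prod = V * gaussianFactor γ lam j * W ∧
      ∀ a : Fin (2 * n), (a : ℕ) / 2 = j → Commute (γ a) V ∧ Commute (γ a) W := fun j => by
    obtain ⟨s, t, rfl⟩ := List.append_of_mem (hmem j)
    have hst := List.nodup_middle.1 hl
    rw [List.nodup_cons, List.mem_append, not_or] at hst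
    refine ⟨(s.map (gaussianFactor γ lam)).prod, (t.map (gaussianFactor γ lam)).prod, by
      rw [List.map_append, List.prod_append, List.map_cons, List.prod_cons, ← mul_assoc],
      fun a ha => ⟨hγ.commute_gaussianFactor_prod lam fun k hk h => ?_,
      hγ.commute_gaussianFactor_prod lam fun k hk h => ?_⟩⟩
    · exact hst.1.1 (Fin.ext (ha.symm.trans h) ▸ hk)
    · exact hst.1.2 (Fin.ext (ha.symm.trans h) ▸ hk)
  -- `V` and `W` are spectators in the commutation relation of a single factor `P`
  have sandwich : ∀ {A B V P W : Operator n} {c : ℂ}, Commute A V → Commute A W → Commute B V →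
      Commute B W → A * P - P * A = c • (B * P + P * B) →
      A * (((2 : ℂ) ^ n)⁻¹ • (V * P * W)) - (((2 : ℂ) ^ n)⁻¹ • (V * P * W)) * A =
        c • (B * (((2 : ℂ) ^ n)⁻¹ • (V * P * W)) + (((2 : ℂ) ^ n)⁻¹ • (V * P * W)) * B) := by
    intro A B V P W c hAV hAW hBV hBW h
    have e1 : ∀ {A : Operator n}, Commute A V → A * (V * P * W) = V * (A * P) * W := fun hA => by
      rw [← mul_assoc, ← mul_assoc, hA.eq]; simp only [mul_assoc]
    have e2 : ∀ {A : Operator n}, Commute A W → V * P * W * A = V * (P * A) * W := fun hA => by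
      rw [mul_assoc, ← hA.eq]; simp only [mul_assoc]
    rw [mul_smul_comm, smul_mul_assoc, mul_smul_comm, smul_mul_assoc, ← smul_sub, ← smul_add,
      e1 hAV, e1 hBV, e2 hAW, e2 hBW, ← sub_mul, ← mul_sub, ← add_mul, ← mul_add, h,
      mul_smul_comm, smul_mul_assoc, smul_comm]
  refine hasCovariance_blockCovariance ?_ (fun j => ?_) fun j => ?_
  · rw [trace_smul, hγ.trace_gaussianFactor_prod lam hl, smul_eq_mul, inv_mul_cancel₀ (by simp)]
  all_goals
    obtain ⟨V, W, hVW, hcomm⟩ := key j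
    have h0 := hcomm ⟨2 * j, by omega⟩ (by simp)
    have h1 := hcomm ⟨2 * j + 1, by omega⟩ (by simp only; omega)
    have hf := commutator_factor (Complex.I * lam j) (hγ.mul_self ⟨2 * j, by omega⟩)
      (hγ.mul_self ⟨2 * j + 1, by omega⟩) (hγ.mul_comm_of_ne (by simp))
    rw [hVW]
  · exact sandwich h0.1 h0.2 h1.1 h1.2 hf.1
  · exact sandwich h1.1 h1.2 h0.1 h0.2 hf.2

end Product

/-- A pure Gaussian state is annihilated by the rotated operators `γ_{2j} + i γ_{2j+1}`, so its
covariance has all `λ_j = -1` in the rotated frame. -/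
lemma hasCovariance_pure {U : Operator n} (hU : U ∈ unitaryGroup (Basis n) ℂ) :
    HasCovariance (fun i => U * majorana n i * Uᴴ)
      (vecMulVec (U *ᵥ zeroState n) (star (U *ᵥ zeroState n))) (blockCovariance fun _ => -1) := by
  have hU' : Uᴴ * U = 1 := mem_unitaryGroup_iff'.1 hU
  set ψ := U *ᵥ zeroState n with hψ
  set ρ := vecMulVec ψ (star ψ) with hρ
  have hρH : ρᴴ = ρ := by rw [hρ, conjTranspose_vecMulVec, star_star]
  have hγH : ∀ i, (U * majorana n i * Uᴴ)ᴴ = U * majorana n i * Uᴴ := fun i => by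
    simp only [conjTranspose_mul, conjTranspose_conjTranspose, majorana_conjTranspose, mul_assoc]
  have hann : ∀ j : Fin n, U * majorana n ⟨2 * j, by omega⟩ * Uᴴ * ρ =
      -Complex.I • (U * majorana n ⟨2 * j + 1, by omega⟩ * Uᴴ * ρ) := fun j => by
    have h : ∀ i, (U * majorana n i * Uᴴ) *ᵥ ψ = U *ᵥ (majorana n i *ᵥ zeroState n) := fun i => by
      rw [hψ, mulVec_mulVec, mul_assoc, hU', mul_one, mulVec_mulVec]
    rw [hρ, mul_vecMulVec, mul_vecMulVec, h, h, majorana_mulVec_zeroState, mulVec_smul,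
      smul_vecMulVec]
  have hann' : ∀ j : Fin n, ρ * (U * majorana n ⟨2 * j, by omega⟩ * Uᴴ) =
      Complex.I • (ρ * (U * majorana n ⟨2 * j + 1, by omega⟩ * Uᴴ)) := fun j => by
    have h := congrArg conjTranspose (hann j)
    rw [conjTranspose_smul, conjTranspose_mul, conjTranspose_mul (_ * _ * _), hγH, hγH, hρH] at h
    simpa using h
  refine hasCovariance_blockCovariance ?_ (fun j => ?_) fun j => ?_
  · rw [hρ, trace_vecMulVec, dotProduct_comm, hψ, star_mulVec, ← dotProduct_mulVec, mulVec_mulVec,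
      hU', one_mulVec]
    simp [zeroState]
  · simp only [hann, hann', smul_add]
    push_cast
    simp [sub_eq_add_neg]
  · simp only [hann, hann', smul_add, smul_smul]
    push_cast
    simp [sub_eq_add_neg]

/-- Every Gaussian state has a covariance matrix, obtained by rotating a block diagonal one. -/
lemma IsGaussian.exists_hasCovariance {ρ : Operator n} (h : IsGaussian ρ) :
    ∃ Γ, HasCovariance (majorana n) ρ Γ ∧ ∑ a, ∑ b, Γ a b ^ 2 ≤ 2 * n := by
  rcases h with ⟨_, ⟨U, R, ⟨hU, hR, hUR⟩, rfl⟩, rfl⟩ | ⟨U, R, lam, ⟨hU, hR, hUR⟩, hlam, rfl⟩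
  · have hR' : R ∈ orthogonalGroup _ ℝ := (mem_specialOrthogonalGroup_iff.1 hR).1
    have hUU : U * Uᴴ = 1 := mem_unitaryGroup_iff.1 hU
    refine ⟨_, (hasCovariance_pure hU).rotate hR' fun i => ?_, ?_⟩
    · have h := congrArg (fun y => U * y * Uᴴ) (hUR i)
      simp only [Finset.mul_sum, Finset.sum_mul, mul_smul_comm, smul_mul_assoc] at h
      rw [← h]
      calc _ = (U * Uᴴ) * majorana n i * (U * Uᴴ) := by rw [hUU, one_mul, mul_one]
        _ = _ := by simp only [mul_assoc]
    · rw [sum_sq_orthogonal_conj hR']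
      exact sum_sq_blockCovariance_le (by simp)
  · have hR' : Rᵀ ∈ orthogonalGroup _ ℝ := by
      have := (mem_specialOrthogonalGroup_iff.1 hR).1
      rw [mem_orthogonalGroup_iff'] at this
      rw [mem_orthogonalGroup_iff, transpose_transpose, this]
    have hγ : IsClifford fun i => Uᴴ * majorana n i * U :=
      isClifford_majorana.of_conj (mem_unitaryGroup_iff.1 hU)
    have hcov := hγ.hasCovariance_gaussianFactor_prod lam (List.nodup_finRange n)
      (List.mem_finRange)
    rw [← List.ofFn_eq_map] at hcov
    refine ⟨_, HasCovariance.rotate hcov hR' fun i => ?_, ?_⟩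
    · have hRR : Rᵀ * R = 1 :=
        (mem_orthogonalGroup_iff' _ _).1 (mem_specialOrthogonalGroup_iff.1 hR).1
      simp only [hUR, transpose_apply, Finset.smul_sum, smul_smul]
      rw [Finset.sum_comm]
      simp only [← Finset.sum_smul]
      have : ∀ k, ∑ j, (R j i : ℂ) * (R j k : ℂ) = if i = k then 1 else 0 := fun k => by
        have := congrFun (congrFun hRR i) k
        simp only [mul_apply, transpose_apply, one_apply] at this
        rw [← Complex.ofReal_one, ← Complex.ofReal_zero, ← apply_ite Complex.ofReal, ← this]
        push_cast
        rfl
      simp [this]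
    · rw [sum_sq_orthogonal_conj hR']
      exact sum_sq_blockCovariance_le hlam

/-- The energy of a state with covariance matrix `Γ` is a quadratic form in `Γ`. -/
lemma HasCovariance.energy_hamiltonian {ρ : Operator n} {Γ : Matrix (Fin (2 * n)) (Fin (2 * n)) ℝ}
    (h : HasCovariance (majorana n) ρ Γ) (p : ℝ) (J X : Interaction n 4 → ℝ) :
    energy (hamiltonian n 4 p J X) ρ = (√((2 * n).choose 4 : ℝ))⁻¹ * (√p)⁻¹ *
      ∑ I : Interaction n 4, pairing (I.1.orderEmbOfFin I.2) Γ Γ * (J I * X I) := by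
  have h1 : ∀ I : Interaction n 4, (majoranaProd n I.1 * ρ).trace =
      -(pairing (I.1.orderEmbOfFin I.2) Γ Γ : ℂ) := fun I => by
    rw [majoranaProd_eq, h.trace_mul_four isClifford_majorana (RelEmbedding.injective _)]
  have h2 : (hamiltonian n 4 p J X * ρ).trace = (((√((2 * n).choose 4 : ℝ))⁻¹ * (√p)⁻¹ *
      ∑ I : Interaction n 4, pairing (I.1.orderEmbOfFin I.2) Γ Γ * (J I * X I) : ℝ) : ℂ) := by
    simp only [hamiltonian, smul_mul_assoc, trace_smul, Finset.sum_mul, trace_sum, h1, smul_eq_mul]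
    norm_num [Complex.I_sq, Finset.sum_neg_distrib]
    left
    exact Finset.sum_congr rfl fun I _ => mul_comm _ _
  rw [energy, h2, Complex.ofReal_re]

end Gaussian

/-! ### Half-nets of the unit ball -/

section Net

variable {E : Type*} [NormedAddCommGroup E] [NormedSpace ℝ E] [FiniteDimensional ℝ E]

/-- The unit ball has a `1/2`-net of at most `5 ^ dim E` points: a maximal `1/2`-separated subset,
whose cardinality is controlled by comparing volumes. -/
lemma exists_half_net : ∃ N : Finset E, N.card ≤ 5 ^ Module.finrank ℝ E ∧
    (∀ x ∈ N, ‖x‖ ≤ 1) ∧ ∀ x : E, ‖x‖ ≤ 1 → ∃ y ∈ N, ‖x - y‖ ≤ 1 / 2 := by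
  classical
  let P : Finset E → Prop := fun s => (∀ x ∈ s, ‖x‖ ≤ 1) ∧
    ∀ c ∈ s, ∀ d ∈ s, c ≠ d → 1 / 2 ≤ ‖c - d‖
  have hcard : ∀ s, P s → s.card ≤ 5 ^ Module.finrank ℝ E := fun s hs => by
    have hinj : Function.Injective (fun x : E => (2 : ℝ) • x) :=
      smul_right_injective E (two_ne_zero)
    rw [← Finset.card_image_of_injective s hinj]
    refine Besicovitch.card_le_of_separated _ ?_ ?_
    · intro c hc
      obtain ⟨x, hx, rfl⟩ := Finset.mem_image.1 hc
      have := hs.1 x hx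
      simp only [norm_smul, Real.norm_ofNat]
      linarith
    · intro c hc d hd hcd
      obtain ⟨x, hx, rfl⟩ := Finset.mem_image.1 hc
      obtain ⟨y, hy, rfl⟩ := Finset.mem_image.1 hd
      have := hs.2 x hx y hy (fun h => hcd (by rw [h]))
      simp only [← smul_sub, norm_smul, Real.norm_ofNat]
      linarith
  have hex : ∃ k, ∃ s, P s ∧ 5 ^ Module.finrank ℝ E - s.card = k := ⟨_, ∅, by simp [P], rfl⟩
  obtain ⟨N, hN, hNk⟩ := Nat.find_spec hex
  refine ⟨N, hcard N hN, hN.1, fun x hx => ?_⟩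
  by_contra! hfar
  have hxN : x ∉ N := fun h => by
    have := hfar x h
    rw [sub_self, norm_zero] at this
    linarith
  have hP : P (insert x N) := by
    refine ⟨fun y hy => ?_, fun c hc d hd hcd => ?_⟩
    · rcases Finset.mem_insert.1 hy with rfl | hy
      exacts [hx, hN.1 y hy]
    · rcases Finset.mem_insert.1 hc with hc | hc <;> rcases Finset.mem_insert.1 hd with hd | hd
      · exact absurd (hc.trans hd.symm) hcd
      · rw [hc]; exact (hfar d hd).le
      · rw [hd, norm_sub_rev]; exact (hfar c hc).le
      · exact hN.2 c hc d hd hcd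
  have h1 := hcard _ hP
  have h2 := Nat.find_min' hex ⟨_, hP, rfl⟩
  rw [Finset.card_insert_of_notMem hxN] at h1 h2
  omega

/-- A one-sided bound of a linear functional on a `1/2`-net bounds it on the unit ball, at the cost
of a factor `2`. -/
lemma linear_le_of_half_net {N : Finset E}
    (hN : ∀ x : E, ‖x‖ ≤ 1 → ∃ y ∈ N, ‖x - y‖ ≤ 1 / 2) (f : E →ₗ[ℝ] ℝ) {A : ℝ}
    (hA : ∀ y ∈ N, f y ≤ A) {x : E} (hx : ‖x‖ ≤ 1) : f x ≤ 2 * A := by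
  let F : E →L[ℝ] ℝ := LinearMap.toContinuousLinearMap f
  have hF : ∀ x, F x = f x := fun _ => rfl
  have h1 : ∀ x : E, ‖x‖ ≤ 1 → F x ≤ A + ‖F‖ / 2 := fun x hx => by
    obtain ⟨y, hy, hxy⟩ := hN x hx
    have h2 : F (x - y) ≤ ‖F‖ * (1 / 2) :=
      (le_abs_self _).trans ((F.le_opNorm (x - y)).trans (by gcongr))
    rw [map_sub] at h2
    have h3 := hA y hy
    rw [← hF] at h3
    linarith
  have h0 : 0 ≤ A + ‖F‖ / 2 := by simpa using h1 0 (by simp)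
  have h2 : ‖F‖ ≤ A + ‖F‖ / 2 := by
    refine F.opNorm_le_of_unit_norm h0 fun x hx => abs_le.2 ⟨?_, h1 x hx.le⟩
    have := h1 (-x) (by simp [hx])
    rw [map_neg] at this
    linarith
  have h3 := h1 x hx
  rw [hF] at h3
  linarith

lemma bilinear_le_of_half_net {N : Finset E}
    (hN : ∀ x : E, ‖x‖ ≤ 1 → ∃ y ∈ N, ‖x - y‖ ≤ 1 / 2) (B : E →ₗ[ℝ] E →ₗ[ℝ] ℝ) {A : ℝ}
    (hA : ∀ x ∈ N, ∀ y ∈ N, B x y ≤ A) {x y : E} (hx : ‖x‖ ≤ 1) (hy : ‖y‖ ≤ 1) :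
    B x y ≤ 4 * A := by
  have h1 : ∀ y ∈ N, B x y ≤ 2 * A := fun y hy =>
    linear_le_of_half_net hN (B.flip y) (fun z hz => hA z hz y hy) hx
  have := linear_le_of_half_net hN (B x) h1 hy
  linarith

end Net

/-! ### Concentration of the sparse Gaussian couplings -/

section Concentration

variable {Ω : Type*} [MeasurableSpace Ω] {μ : Measure Ω} [IsProbabilityMeasure μ]

/-- A standard Gaussian variable times an independent Bernoulli variable is sub-Gaussian with
variance proxy `1`: its moment generating function is `(1 - p) + p exp (t² / 2)`. -/
lemma hasSubgaussianMGF_gaussian_mul_bernoulli {J X : Ω → ℝ} {p : unitInterval}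
    (hJ : HasLaw J (gaussianReal 0 1) μ) (hX : HasLaw X (bernoulliMeasure (1 : ℝ) 0 p) μ)
    (h : IndepFun J X μ) : HasSubgaussianMGF (fun ω => J ω * X ω) 1 μ := by
  have hval : ∀ᵐ ω ∂μ, X ω = 0 ∨ X ω = 1 := by
    have hs : MeasurableSet {x : ℝ | x = 0 ∨ x = 1} :=
      (measurableSet_singleton 0).union (measurableSet_singleton 1)
    have : ∀ᵐ x ∂(μ.map X), x = 0 ∨ x = 1 := by
      rw [hX.map_eq, ae_iff]
      have := bernoulliMeasure_apply (x := (1 : ℝ)) (y := 0) p hs.compl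
      simpa [Set.compl_def] using this
    exact ae_of_ae_map hX.aemeasurable this
  have hae : ∀ t, (fun ω => Real.exp (t * (J ω * X ω))) =ᵐ[μ]
      fun ω => (1 - X ω) + Real.exp (t * J ω) * X ω := fun t => by
    filter_upwards [hval] with ω hω
    rcases hω with h | h <;> simp [h]
  have hXint : Integrable X μ := by
    have h1 := integrable_bernoulliMeasure (1 : ℝ) 0 p (id : ℝ → ℝ)
    rw [← hX.map_eq] at h1
    exact (integrable_map_measure (by fun_prop) hX.aemeasurable).1 h1
  have hXval : ∫ ω, X ω ∂μ = p := by
    have := hX.integral_comp (f := (id : ℝ → ℝ)) (by fun_prop)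
    rw [integral_bernoulliMeasure] at this
    simpa using this
  have hJint : ∀ t, Integrable (fun ω => Real.exp (t * J ω)) μ := fun t => by
    have h1 := integrable_exp_mul_gaussianReal (μ := 0) (v := 1) t
    rw [← hJ.map_eq] at h1
    exact (integrable_map_measure (by fun_prop) hJ.aemeasurable).1 h1
  have hJval : ∀ t, ∫ ω, Real.exp (t * J ω) ∂μ = Real.exp (t ^ 2 / 2) := fun t => by
    simpa [mgf] using mgf_gaussianReal hJ.map_eq t
  have hind : ∀ t, IndepFun (fun ω => Real.exp (t * J ω)) X μ := fun t =>
    h.comp (φ := fun x => Real.exp (t * x)) (ψ := id) (by fun_prop) measurable_id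
  have hprod : ∀ t, Integrable (fun ω => Real.exp (t * J ω) * X ω) μ := fun t =>
    (hind t).integrable_mul (hJint t) hXint
  refine ⟨fun t => ?_, fun t => ?_⟩
  · exact (((integrable_const 1).sub hXint).add (hprod t)).congr (hae t).symm
  · rw [mgf, integral_congr_ae (hae t),
      integral_add (by exact (integrable_const 1).sub hXint) (hprod t),
      integral_sub (integrable_const 1) hXint,
      (hind t).integral_fun_mul_eq_mul_integral (hJint t).1 hXint.1, hJval, hXval]
    have h1 : 1 ≤ Real.exp (t ^ 2 / 2) := Real.one_le_exp (by positivity)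
    have h2 : (p : ℝ) ≤ 1 := p.2.2
    simp only [integral_const, probReal_univ, smul_eq_mul, NNReal.coe_one, one_mul, mul_one]
    nlinarith

/-- Linear combinations of the sparse couplings `J_I X_I` are sub-Gaussian, with the same variance
proxy as without sparsification. -/
lemma IsDisorder.hasSubgaussianMGF_sum {n q : ℕ} {p : unitInterval} {J X : Interaction n q → Ω → ℝ}
    (h : IsDisorder μ p J X) (c : Interaction n q → ℝ) (s : Finset (Interaction n q)) :
    HasSubgaussianMGF (fun ω => ∑ I ∈ s, c I * (J I ω * X I ω)) (∑ I ∈ s, ‖c I‖₊ ^ 2) μ := by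
  classical
  have hmeas : ∀ i, AEMeasurable (Sum.elim J X i) μ := by
    rintro (I | I)
    exacts [(h.law_J I).aemeasurable, (h.law_X I).aemeasurable]
  have hJX : ∀ I, IndepFun (J I) (X I) μ := fun I =>
    h.indep.indepFun (i := Sum.inl I) (j := Sum.inr I) (by simp)
  induction s using Finset.induction_on with
  | empty => simp
  | insert I s hI ih =>
    simp only [Finset.sum_insert hI]
    refine HasSubgaussianMGF.add_of_indepFun ?_ ih ?_
    · convert (hasSubgaussianMGF_gaussian_mul_bernoulli (h.law_J I) (h.law_X I)
        (hJX I)).const_mul (c I) using 1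
      refine ((mul_one (M := NNReal) ⟨c I ^ 2, sq_nonneg _⟩).trans (NNReal.eq ?_)).symm
      rw [NNReal.coe_pow, coe_nnnorm, Real.norm_eq_abs, sq_abs]
      rfl
    · have hdisj : Disjoint (({I} : Finset (Interaction n q)).disjSum {I}) (s.disjSum s) := by
        rw [Finset.disjoint_left]
        rintro (a | a) ha hb
        · simp only [Finset.inl_mem_disjSum, Finset.mem_singleton] at ha hb
          exact hI (ha ▸ hb)
        · simp only [Finset.inr_mem_disjSum, Finset.mem_singleton] at ha hb
          exact hI (ha ▸ hb)
      have hi := h.indep.indepFun_finset₀ _ _ hdisj hmeas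
      have h1 : Measurable fun g : ({x // x ∈ ({I} : Finset (Interaction n q)).disjSum {I}} → ℝ) =>
          c I * (g ⟨Sum.inl I, by simp⟩ * g ⟨Sum.inr I, by simp⟩) := by fun_prop
      have h2 : Measurable fun g : ({x // x ∈ s.disjSum s} → ℝ) =>
          ∑ K : s, c K * (g ⟨Sum.inl K, by simp⟩ * g ⟨Sum.inr K, by simp⟩) := by fun_prop
      convert hi.comp h1 h2 using 1
      · rfl
      · funext ω
        exact (Finset.sum_coe_sort s fun K => c K * (J K ω * X K ω)).symm

lemma IsDisorder.measure_sum_ge_le {n q : ℕ} {p : unitInterval} {J X : Interaction n q → Ω → ℝ}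
    (h : IsDisorder μ p J X) {c : Interaction n q → ℝ} {v : NNReal} (hc : ∑ I, c I ^ 2 ≤ v)
    {t : ℝ} (ht : 0 ≤ t) :
    μ.real {ω | t ≤ ∑ I, c I * (J I ω * X I ω)} ≤ Real.exp (-t ^ 2 / (2 * v)) := by
  have h1 := h.hasSubgaussianMGF_sum c Finset.univ
  have h2 : HasSubgaussianMGF (fun ω => ∑ I, c I * (J I ω * X I ω)) v μ := by
    refine ⟨h1.integrable_exp_mul, fun s => (h1.mgf_le s).trans ?_⟩
    have : ((∑ I, ‖c I‖₊ ^ 2 : NNReal) : ℝ) ≤ v := by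
      push_cast
      simpa using hc
    gcongr
  exact h2.measure_ge_le ht

end Concentration

/-! ### The quadratic form of the couplings -/

section CouplingForm

variable {n : ℕ}

/-- The space of `2n × 2n` matrices with the Frobenius norm. -/
abbrev CovarianceSpace (n : ℕ) : Type := EuclideanSpace ℝ (Fin (2 * n) × Fin (2 * n))

/-- The bilinear form on covariance matrices given by `pairing` on the rows in `I`. -/
noncomputable def pairingForm (I : Interaction n 4) :
    CovarianceSpace n →ₗ[ℝ] CovarianceSpace n →ₗ[ℝ] ℝ :=
  LinearMap.mk₂ ℝ (fun M M' => pairing (I.1.orderEmbOfFin I.2) (fun a b => M (a, b))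
    fun a b => M' (a, b))
    (fun _ _ _ => by simp only [pairing, PiLp.add_apply]; ring)
    (fun _ _ _ => by simp only [pairing, PiLp.smul_apply, smul_eq_mul]; ring)
    (fun _ _ _ => by simp only [pairing, PiLp.add_apply]; ring)
    (fun _ _ _ => by simp only [pairing, PiLp.smul_apply, smul_eq_mul]; ring)

lemma sum_sq_mul_sq_le (M M' : CovarianceSpace n) {i j k l : Fin 4}
    (h : ∀ m, m = i ∨ m = j ∨ m = k ∨ m = l) :
    ∑ I : Interaction n 4, (M (I.1.orderEmbOfFin I.2 i, I.1.orderEmbOfFin I.2 j) *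
      M' (I.1.orderEmbOfFin I.2 k, I.1.orderEmbOfFin I.2 l)) ^ 2 ≤ ‖M‖ ^ 2 * ‖M'‖ ^ 2 := by
  let g : Interaction n 4 → (Fin (2 * n) × Fin (2 * n)) × (Fin (2 * n) × Fin (2 * n)) := fun I =>
    ((I.1.orderEmbOfFin I.2 i, I.1.orderEmbOfFin I.2 j),
      (I.1.orderEmbOfFin I.2 k, I.1.orderEmbOfFin I.2 l))
  have hg : Function.Injective g := by
    intro I I' hII
    simp only [g, Prod.mk.injEq] at hII
    have hv : ⇑(I.1.orderEmbOfFin I.2) = I'.1.orderEmbOfFin I'.2 := by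
      funext m
      rcases h m with rfl | rfl | rfl | rfl
      exacts [hII.1.1, hII.1.2, hII.2.1, hII.2.2]
    refine Subtype.ext (Finset.coe_injective ?_)
    rw [← Finset.range_orderEmbOfFin I.1 I.2, hv, Finset.range_orderEmbOfFin]
  calc _ = ∑ q ∈ Finset.univ.map ⟨g, hg⟩, (M q.1 * M' q.2) ^ 2 := by
        rw [Finset.sum_map]; rfl
    _ ≤ ∑ q : (Fin (2 * n) × Fin (2 * n)) × (Fin (2 * n) × Fin (2 * n)), (M q.1 * M' q.2) ^ 2 :=
        Finset.sum_le_univ_sum_of_nonneg fun _ => sq_nonneg _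
    _ = _ := by
        rw [EuclideanSpace.real_norm_sq_eq, EuclideanSpace.real_norm_sq_eq, Finset.sum_mul_sum,
          Fintype.sum_prod_type]
        simp only [mul_pow]

lemma sum_pairingForm_sq_le {M M' : CovarianceSpace n} (hM : ‖M‖ ≤ 1) (hM' : ‖M'‖ ≤ 1) :
    ∑ I, pairingForm I M M' ^ 2 ≤ 9 := by
  have h1 := sum_sq_mul_sq_le M M' (i := 3) (j := 2) (k := 1) (l := 0) (by decide)
  have h2 := sum_sq_mul_sq_le M M' (i := 3) (j := 1) (k := 2) (l := 0) (by decide)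
  have h3 := sum_sq_mul_sq_le M M' (i := 3) (j := 0) (k := 2) (l := 1) (by decide)
  have h4 : ‖M‖ ^ 2 * ‖M'‖ ^ 2 ≤ 1 :=
    mul_le_one₀ (pow_le_one₀ (norm_nonneg _) hM) (by positivity) (pow_le_one₀ (norm_nonneg _) hM')
  have h5 : ∀ I : Interaction n 4, pairingForm I M M' ^ 2 ≤
      3 * (M (I.1.orderEmbOfFin I.2 3, I.1.orderEmbOfFin I.2 2) *
        M' (I.1.orderEmbOfFin I.2 1, I.1.orderEmbOfFin I.2 0)) ^ 2 +
      3 * (M (I.1.orderEmbOfFin I.2 3, I.1.orderEmbOfFin I.2 1) *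
        M' (I.1.orderEmbOfFin I.2 2, I.1.orderEmbOfFin I.2 0)) ^ 2 +
      3 * (M (I.1.orderEmbOfFin I.2 3, I.1.orderEmbOfFin I.2 0) *
        M' (I.1.orderEmbOfFin I.2 2, I.1.orderEmbOfFin I.2 1)) ^ 2 := fun I => by
    have : ∀ x y z : ℝ, (x - y + z) ^ 2 ≤ 3 * x ^ 2 + 3 * y ^ 2 + 3 * z ^ 2 := fun x y z => by
      nlinarith [sq_nonneg (x + y), sq_nonneg (x - z), sq_nonneg (y + z)]
    exact this _ _ _
  refine (Finset.sum_le_sum fun I _ => h5 I).trans ?_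
  simp only [Finset.sum_add_distrib, ← Finset.mul_sum]
  linarith

variable {Ω : Type*} [MeasurableSpace Ω] {μ : Measure Ω} [IsProbabilityMeasure μ]

/-- Outside an event of exponentially small probability, the quadratic form of the couplings is at
most `72 n` on the unit ball. The net has at most `5 ^ (4 n²)` points, hence at most
`25 ^ (4 n²) ≤ exp (16 n²)` pairs, and each pair violates the bound `18 n` with probability at most
`exp (- 18 n²)`. -/
lemma IsDisorder.exists_bad_event {p : unitInterval} {J X : Interaction n 4 → Ω → ℝ}
    (h : IsDisorder μ p J X) : ∃ S : Set Ω, μ.real S ≤ Real.exp (-(n : ℝ) ^ 2) ∧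
      ∀ ω ∉ S, ∀ M : CovarianceSpace n, ‖M‖ ≤ 1 →
        ∑ I, pairingForm I M M * (J I ω * X I ω) ≤ 72 * n := by
  obtain ⟨N, hcard, hN1, hN⟩ := exists_half_net (E := CovarianceSpace n)
  have hdim : Module.finrank ℝ (CovarianceSpace n) = 4 * n ^ 2 := by
    rw [finrank_euclideanSpace, Fintype.card_prod, Fintype.card_fin]
    ring
  rw [hdim] at hcard
  refine ⟨⋃ z ∈ N ×ˢ N, {ω | 18 * n ≤ ∑ I, pairingForm I z.1 z.2 * (J I ω * X I ω)}, ?_, ?_⟩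
  · have h1 : ∀ z ∈ N ×ˢ N, μ.real {ω | 18 * n ≤ ∑ I, pairingForm I z.1 z.2 * (J I ω * X I ω)} ≤
        Real.exp (-18 * (n : ℝ) ^ 2) := fun z hz => by
      obtain ⟨hz1, hz2⟩ := Finset.mem_product.1 hz
      have := h.measure_sum_ge_le (c := fun I => pairingForm I z.1 z.2) (v := 9) (t := 18 * n)
        (by simpa using sum_pairingForm_sq_le (hN1 _ hz1) (hN1 _ hz2)) (by positivity)
      refine this.trans (Real.exp_le_exp.2 (le_of_eq ?_))
      push_cast
      ring
    have h2 : ((N ×ˢ N).card : ℝ) ≤ Real.exp (16 * (n : ℝ) ^ 2) := by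
      have h3 : (25 : ℝ) ≤ Real.exp 4 := by
        have := Real.exp_one_gt_d9
        calc (25 : ℝ) ≤ 2.7 ^ 4 := by norm_num
          _ ≤ Real.exp 1 ^ 4 := by gcongr; linarith
          _ = Real.exp 4 := by rw [← Real.exp_nat_mul]; norm_num
      calc ((N ×ˢ N).card : ℝ) = (N.card : ℝ) * N.card := by
            rw [Finset.card_product, Nat.cast_mul]
        _ ≤ 5 ^ (4 * n ^ 2) * 5 ^ (4 * n ^ 2) := by gcongr <;> exact_mod_cast hcard
        _ = 25 ^ (4 * n ^ 2) := by rw [← mul_pow]; norm_num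
        _ ≤ Real.exp 4 ^ (4 * n ^ 2) := by gcongr
        _ = _ := by
          rw [← Real.exp_nat_mul]
          congr 1
          push_cast
          ring
    calc _ ≤ ∑ z ∈ N ×ˢ N, μ.real {ω | 18 * n ≤ ∑ I, pairingForm I z.1 z.2 * (J I ω * X I ω)} :=
          measureReal_biUnion_finset_le _ _
      _ ≤ (N ×ˢ N).card * Real.exp (-18 * (n : ℝ) ^ 2) := by
          rw [← nsmul_eq_mul]
          exact Finset.sum_le_card_nsmul _ _ _ h1
      _ ≤ Real.exp (16 * (n : ℝ) ^ 2) * Real.exp (-18 * (n : ℝ) ^ 2) := by gcongr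
      _ ≤ _ := by
          rw [← Real.exp_add]
          refine Real.exp_le_exp.2 ?_
          nlinarith [sq_nonneg (n : ℝ)]
  · intro ω hω M hM
    simp only [Set.mem_iUnion, Set.mem_ofPred_eq, not_exists, not_le, Finset.mem_product] at hω
    let B : CovarianceSpace n →ₗ[ℝ] CovarianceSpace n →ₗ[ℝ] ℝ :=
      ∑ I, (J I ω * X I ω) • pairingForm I
    have hB : ∀ x y, B x y = ∑ I, pairingForm I x y * (J I ω * X I ω) := fun x y => by
      simp only [B, LinearMap.sum_apply, LinearMap.smul_apply, smul_eq_mul]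
      exact Finset.sum_congr rfl fun I _ => mul_comm _ _
    rw [← hB]
    refine (bilinear_le_of_half_net hN B (A := 18 * n) (fun x hx y hy => ?_) hM hM).trans
      (by linarith)
    rw [hB]
    exact (hω (x, y) ⟨hx, hy⟩).le

end CouplingForm

lemma sq_div_five_le_sqrt_choose {n : ℕ} (hn : 3 ≤ n) :
    (n : ℝ) ^ 2 / 5 ≤ √((2 * n).choose 4 : ℝ) := by
  have h1 : n ^ 4 ≤ 24 * (2 * n).choose 4 := by
    have h2 := Nat.pow_sub_le_descFactorial (2 * n) 4
    rw [Nat.descFactorial_eq_factorial_mul_choose] at h2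
    exact (Nat.pow_le_pow_left (by omega) 4).trans h2
  have h2 : (n : ℝ) ^ 4 ≤ 24 * ((2 * n).choose 4 : ℝ) := by exact_mod_cast h1
  refine Real.le_sqrt_of_sq_le ?_
  nlinarith [sq_nonneg ((n : ℝ) ^ 2)]

/-- A covariance matrix has squared Frobenius norm at most `2 n`, so the energy is at most
`2 n * 72 n = 144 n ^ 2` divided by `binom(2n, 4)^(1/2) p^(1/2)`. -/
lemma energy_le {n : ℕ} (hn : 3 ≤ n) {p : ℝ} {J X : Interaction n 4 → ℝ}
    (hJX : ∀ M : CovarianceSpace n, ‖M‖ ≤ 1 →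
      ∑ I, pairingForm I M M * (J I * X I) ≤ 72 * n) {ρ : Operator n} (hρ : IsGaussian ρ) :
    energy (hamiltonian n 4 p J X) ρ ≤ 720 * (√p)⁻¹ := by
  obtain ⟨Γ, hcov, hΓ⟩ := hρ.exists_hasCovariance
  have hn0 : (0 : ℝ) < n := by exact_mod_cast (by omega : 0 < n)
  let M : CovarianceSpace n := WithLp.toLp 2 fun z => Γ z.1 z.2
  have hM : ‖M‖ ^ 2 ≤ 2 * n := by
    rw [EuclideanSpace.real_norm_sq_eq, Fintype.sum_prod_type]
    exact hΓ
  let r : ℝ := √(2 * n)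
  have hr : 0 < r := Real.sqrt_pos.2 (by positivity)
  have hr2 : r ^ 2 = 2 * n := Real.sq_sqrt (by positivity)
  have hM1 : ‖r⁻¹ • M‖ ≤ 1 := by
    rw [norm_smul, norm_inv, Real.norm_of_nonneg hr.le, inv_mul_le_iff₀ hr, mul_one]
    exact Real.le_sqrt_of_sq_le hM
  have hquad : ∑ I, pairingForm I M M * (J I * X I) ≤ 144 * n ^ 2 := by
    have h1 := hJX _ hM1
    have h2 : ∑ I, pairingForm I (r⁻¹ • M) (r⁻¹ • M) * (J I * X I) =
        (r ^ 2)⁻¹ * ∑ I, pairingForm I M M * (J I * X I) := by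
      rw [Finset.mul_sum]
      refine Finset.sum_congr rfl fun I _ => ?_
      rw [LinearMap.map_smul₂, map_smul, smul_eq_mul, smul_eq_mul]
      ring
    rw [h2, hr2, inv_mul_le_iff₀ (by positivity)] at h1
    linarith
  have hc := sq_div_five_le_sqrt_choose hn
  have hc0 : 0 < √((2 * n).choose 4 : ℝ) := lt_of_lt_of_le (by positivity) hc
  rw [hcov.energy_hamiltonian, mul_right_comm]
  refine mul_le_mul_of_nonneg_right ?_ (inv_nonneg.2 (Real.sqrt_nonneg p))
  rw [inv_mul_le_iff₀ hc0]
  refine le_trans hquad ?_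
  linarith

end SSYK

theorem theorem2 (C₀ : ℝ) (hC₀ : 0 < C₀) :
    ∃ (K : ℝ) (k : ℕ) (b a : ℝ) (n₀ : ℕ), 0 < K ∧ 0 < b ∧ 0 < a ∧
      ∀ n : ℕ, n₀ ≤ n → ∀ p : unitInterval, C₀ * Real.log n / n ≤ (p : ℝ) →
        ∀ (Ω : Type*) [MeasurableSpace Ω] (μ : Measure Ω) [IsProbabilityMeasure μ]
          (J X : SSYK.Interaction n 4 → Ω → ℝ), SSYK.IsDisorder μ p J X →
          1 - Real.exp (-(b * (n : ℝ) ^ a)) ≤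
            μ.real {ω | ∀ ρ : SSYK.Operator n, SSYK.IsGaussian ρ →
              SSYK.energy (SSYK.hamiltonian n 4 p (fun I => J I ω) (fun I => X I ω)) ρ ≤
                K * Real.log n ^ k * (p : ℝ) ^ (-(1 / 2) : ℝ)} := by
  refine ⟨720, 0, 1, 2, 3, by norm_num, one_pos, two_pos, ?_⟩
  intro n hn p _ Ω _ μ _ J X h
  obtain ⟨S, hS, hgood⟩ := h.exists_bad_event
  have hp : (p : ℝ) ^ (-(1 / 2) : ℝ) = (√(p : ℝ))⁻¹ := by
    rw [Real.rpow_neg p.2.1, Real.sqrt_eq_rpow]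
  rw [one_mul, Real.rpow_two, pow_zero, mul_one, hp]
  set G := {ω | ∀ ρ : SSYK.Operator n, SSYK.IsGaussian ρ →
    SSYK.energy (SSYK.hamiltonian n 4 p (fun I => J I ω) (fun I => X I ω)) ρ ≤
      720 * (√(p : ℝ))⁻¹} with hG
  have hcover : (Set.univ : Set Ω) ⊆ G ∪ S := fun ω _ => by
    by_cases hω : ω ∈ S
    · exact Or.inr hω
    · exact Or.inl fun ρ hρ => SSYK.energy_le hn (hgood ω hω) hρ
  have h1 : 1 ≤ μ.real G + μ.real S := by
    calc (1 : ℝ) = μ.real Set.univ := probReal_univ.symm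
      _ ≤ μ.real (G ∪ S) := measureReal_mono hcover
      _ ≤ _ := measureReal_union_le _ _
  linarith
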